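/- Let $Z$ be a real inner product space with an isometric complex structure $\sigma$ ($\sigma^2=-1$) and vectors $z_1,z_2,\dots$ such that $\{z_k,\sigma(z_k)\}_{k\ge1}$ is an orthonormal system with dense linear span in $Z$. Let $C(Z)$ be the real Clifford algebra with relations $zw+wz+2(z,w)1=0$, and $C_{\mathbb C}(Z)=\mathbb C\otimes_{\mathbb R} C(Z)$. Let $X=\{0,1\}^{\mathbb N}$, with sequences $x=(x_1,x_2,\dots)$, be the compact group with addition mod $2$ in each component, $\delta_k\in X$ the sequence whose only nonzero component is a $1$ in position $k$, $\mathbf 1=(1,1,\dots)$, and $\mu$ a Haar measure on $X$. Define $c_k:X\to\mathbb C$, $k\ge1$, by $$c_{2\ell}(x)=1,\qquad c_{4\ell+1}(x)=(-1)^{x_{4\ell+3}},\qquad c_{4\ell+3}(x)=(-1)^{x_{4\ell+1}}.$$ A subspace is called invariant if it is mapped into itself by all operators of the representation, and a representation by bounded operators is irreducible if the space is nonzero and its only closed invariant subspaces are $0$ and the whole space. **Theorem 3.11.** 1. The $c_k$ are measurable, $|c_k(x)|=1$, $\overline{c_k(x)}=c_k(x+\delta_k)$, and $c_k(x)c_l(x+\delta_k)=c_l(x)c_k(x+\delta_l)$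 for all $k,l,x$. 2. There is a unique representation $\mathbb J$ of $C_{\mathbb C}(Z)$ by bounded operators on $L_2(X)=L_2(X,\mu;\mathbb C)$ such that each $\mathbb J_z$, $z\in Z$, is skew-hermitian and, for all $k$, all $f\in L_2(X)$ and almost all $x$, $$(\mathbb J_{z_k}f)(x)=(-1)^{x_1+\dots+x_{k-1}+1}\,i\,c_k(x)\sqrt{\tfrac{d\mu(x+\delta_k)}{d\mu(x)}}\,f(x+\delta_k),\qquad (\mathbb J_{\sigma(z_k)}f)(x)=(-1)^{x_k}\,i\,(\mathbb J_{z_k}f)(x).$$ (Here $d\mu(x+\delta_k)/d\mu(x)$ is the Radon–Nikodym derivative of the translated measure, which is $1$ almost everywhere.) 3. The representation $\mathbb J$ is irreducible over $\mathbb C$. 4. The real subspace $L_2(X)^{\mathbb R}=\{f\in L_2(X): f(\mathbf 1-x)=\overline{f(x)}\text{ for almost all }x\}$ is invariant under $C(Z)$, and the real representation of $C(Z)$ on it is irreducible over $\mathbb R$. 5. This real representation does not arise from any representation of $C_{\mathbb C}(Z)$ by restriction of scalars: for every complex Hilbert space $W$ and every representation $\tau$ of $C_{\mathbb C}(Z)$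 by bounded operators on $W$, there is no $\mathbb R$-linear homeomorphism $\varphi:L_2(X)^{\mathbb R}\to W$ with $\varphi(af)=\tau(1\otimes a)\varphi(f)$ for all $a\in C(Z)$ and $f\in L_2(X)^{\mathbb R}$. -/

import Mathlib

open MeasureTheory Filter TensorProduct
open scoped ENNReal ComplexConjugate

/-- The group `X = {0,1}^ℕ` of binary sequences `x = (x₁, x₂, …)` under componentwise addition
modulo `2`. -/
abbrev BinSeq : Type := ℕ+ → ZMod 2

/-- The sequence `δ_k` whose `k`-th component is `1` and whose other components are `0`. -/
def BinSeq.delta (k : ℕ+) : BinSeq := Pi.single k 1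

/-- The sign `(-1)^a` of an element `a` of `{0,1}`. -/
noncomputable def bitSign (a : ZMod 2) : ℂ := (-1) ^ a.val

/-- The functions `c_{2ℓ}(x) = 1`, `c_{4ℓ+1}(x) = (-1)^{x_{4ℓ+3}}`,
`c_{4ℓ+3}(x) = (-1)^{x_{4ℓ+1}}`. -/
noncomputable def splitCoeff (k : ℕ+) (x : BinSeq) : ℂ :=
  if (k : ℕ) % 4 = 1 then bitSign (x (k + 2))
  else if (k : ℕ) % 4 = 3 then bitSign (x (k - 2))
  else 1

/-- The conditions on the coefficients of a Gårding-Wightman module with one-dimensional fibres: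
the `c_k` are measurable functions into the unit circle with `c_k(x)^* = c_k(x + δ_k)` and
`c_k(x) c_l(x + δ_k) = c_l(x) c_k(x + δ_l)`. -/
structure IsGWCoeff (c : ℕ+ → BinSeq → ℂ) : Prop where
  measurable : ∀ k, Measurable (c k)
  norm_eq_one : ∀ k x, ‖c k x‖ = 1
  conj_eq : ∀ k x, conj (c k x) = c k (x + BinSeq.delta k)
  cocycle : ∀ k l x,
    c k x * c l (x + BinSeq.delta k) = c l x * c k (x + BinSeq.delta l)

/-- The Gårding-Wightman formula for the action of the basis vector `z_k`:
`(-1)^{x₁ + ⋯ + x_{k-1} + 1} i c_k(x) √(dμ(x + δ_k)/dμ(x)) f(x + δ_k)`. -/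
noncomputable def gwFormula (μ : Measure BinSeq) (c : ℕ+ → BinSeq → ℂ) (k : ℕ+)
    (f : BinSeq → ℂ) (x : BinSeq) : ℂ :=
  (-1) ^ ((∑ j ∈ Finset.Iio k, (x j).val) + 1) * Complex.I * c k x *
    (Real.sqrt (((μ.map (fun y => y + BinSeq.delta k)).rnDeriv μ x).toReal) : ℂ) *
    f (x + BinSeq.delta k)

section Clifford

variable (Z : Type*) [NormedAddCommGroup Z] [InnerProductSpace ℝ Z]

/-- The quadratic form `z ↦ -(z, z)`. -/
noncomputable def negNormSq : QuadraticForm ℝ Z :=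
  -LinearMap.BilinMap.toQuadraticMap (innerₗ Z)

/-- The real Clifford algebra `C(Z)`, with relations `z w + w z + 2 (z, w) = 0`. -/
abbrev RealCl : Type _ := CliffordAlgebra (negNormSq Z)

/-- The complexified Clifford algebra `ℂ ⊗ C(Z)`. -/
abbrev CplxCl : Type _ := ℂ ⊗[ℝ] RealCl Z

variable {Z}

/-- The generator of `C(Z)` given by `z ∈ Z`. -/
noncomputable def clGen (z : Z) : RealCl Z := CliffordAlgebra.ι (negNormSq Z) z

/-- A representation of `ℂ ⊗ C(Z)` by bounded operators on a complex Hilbert space for which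
`Z` acts by skew-hermitian operators. -/
def IsSkewRep {H : Type*} [NormedAddCommGroup H] [InnerProductSpace ℂ H] [CompleteSpace H]
    (ρ : CplxCl Z →ₐ[ℂ] (H →L[ℂ] H)) : Prop :=
  ∀ z : Z, ContinuousLinearMap.adjoint (ρ (1 ⊗ₜ[ℝ] clGen z)) = -ρ (1 ⊗ₜ[ℝ] clGen z)

/-- `ρ` is given on the real basis `z_k`, `σ(z_k)` of `Z` by the Gårding-Wightman formulas
with parameters `(μ, 1, {c_k})`. -/
structure IsGWRep (σ : Z →ₗᵢ[ℝ] Z) (z : ℕ+ → Z) (μ : Measure BinSeq) (c : ℕ+ → BinSeq → ℂ)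
    (ρ : CplxCl Z →ₐ[ℂ] (Lp ℂ 2 μ →L[ℂ] Lp ℂ 2 μ)) : Prop where
  skew : IsSkewRep ρ
  apply_basis : ∀ (k : ℕ+) (f : Lp ℂ 2 μ),
    ρ (1 ⊗ₜ[ℝ] clGen (z k)) f =ᵐ[μ] gwFormula μ c k f
  apply_sigma_basis : ∀ (k : ℕ+) (f : Lp ℂ 2 μ),
    ρ (1 ⊗ₜ[ℝ] clGen (σ (z k))) f =ᵐ[μ]
      fun x => bitSign (x k) * Complex.I * ρ (1 ⊗ₜ[ℝ] clGen (z k)) f x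

end Clifford

/-- (Topological) irreducibility of an algebra of bounded operators: the space is nonzero and
has no closed invariant subspaces other than `0` and itself. -/
def IsIrredRep {𝕜 A V : Type*} [NontriviallyNormedField 𝕜] [Ring A] [Algebra 𝕜 A]
    [NormedAddCommGroup V] [NormedSpace 𝕜 V] (ρ : A →ₐ[𝕜] (V →L[𝕜] V)) : Prop :=
  Nontrivial V ∧ ∀ U : Submodule 𝕜 V, IsClosed (U : Set V) →
    (∀ a : A, ∀ v ∈ U, ρ a v ∈ U) → U = ⊥ ∨ U = ⊤

theorem BinSeq.quasiMeasurePreserving_one_sub (μ : Measure BinSeq) [μ.IsAddHaarMeasure] :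
    Measure.QuasiMeasurePreserving (fun x : BinSeq => 1 - x) μ μ :=
  (Measure.measurePreserving_sub_left μ (1 : BinSeq)).quasiMeasurePreserving

/-- The real subspace `{f ∈ L₂(X) : f(1 - x) = conj f(x)}` of `L₂(X)`. -/
noncomputable def realForm (μ : Measure BinSeq) [μ.IsAddHaarMeasure] :
    Submodule ℝ (Lp ℂ 2 μ) where
  carrier := {f | (fun x => f (1 - x)) =ᵐ[μ] fun x => conj (f x)}
  zero_mem' := by
    have h := Lp.coeFn_zero ℂ 2 μ
    have h' := (BinSeq.quasiMeasurePreserving_one_sub μ).ae_eq_comp h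
    filter_upwards [h, h'] with x hx hx'
    simp only [Function.comp_apply] at hx'
    rw [hx', hx]
    simp
  add_mem' := by
    intro f g hf hg
    have h := Lp.coeFn_add f g
    have h' := (BinSeq.quasiMeasurePreserving_one_sub μ).ae_eq_comp h
    change (fun x => (f + g : Lp ℂ 2 μ) (1 - x)) =ᵐ[μ] fun x => conj ((f + g : Lp ℂ 2 μ) x)
    filter_upwards [h, h', hf, hg] with x hx hx' hfx hgx
    simp only [Function.comp_apply] at hx'
    rw [hx', hx]
    simp only [Pi.add_apply, map_add, hfx, hgx]
  smul_mem' := by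
    intro r f hf
    have h := Lp.coeFn_smul r f
    have h' := (BinSeq.quasiMeasurePreserving_one_sub μ).ae_eq_comp h
    change (fun x => (r • f : Lp ℂ 2 μ) (1 - x)) =ᵐ[μ] fun x => conj ((r • f : Lp ℂ 2 μ) x)
    filter_upwards [h, h', hf] with x hx hx' hfx
    simp only [Function.comp_apply] at hx'
    rw [hx', hx]
    simp only [Pi.smul_apply, Complex.real_smul, map_mul, Complex.conj_ofReal, hfx]

/-!
The Gårding-Wightman operators of `z_k` and `σ(z_k)` are weighted shifts `f ↦ w · f(· + δ_k)` on
`L²(X)` with unimodular weights; they are skew-adjoint, square to `-1` and anticommute. By the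
C⋆-identity a real combination of such operators has norm at most the norm of the same combination
of the basis vectors, so the assignment extends by continuity to `Z`, uniquely, and hence to the
Clifford algebra.

An operator commuting with all of them commutes with the products of the operators of `σ(z_k)` and
`z_k`, which are multiplications by the characters `(-1)^{x_k}` up to a constant. By
Stone-Weierstrass it commutes with all continuous multipliers and is itself a multiplication. As it
also commutes with the shifts, its multiplier is invariant under the dense subgroup generated by
the `δ_k`, hence constant. Thus the commutant is `ℂ`, and the commutant on the real form, being the
part compatible with the conjugation `f ↦ conj (f (1 - ·))`, is `ℝ`. The orthogonal projection onto
a closed invariant subspace commutes with a skew-adjoint family, so both representations are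
irreducible; a compatible complex structure on the real form would be a real scalar of square `-1`.
-/

section CliffordExtension

variable {ι Z A : Type*} [NormedAddCommGroup Z] [InnerProductSpace ℝ Z]
  [NormedRing A] [StarRing A] [NormedAlgebra ℝ A]

/-- A family `a` of skew-adjoint elements of a `⋆`-algebra satisfying the relations of the family
`v` in the Clifford algebra of `Z`. -/
structure IsSkewCliffordFamily (v : ι → Z) (a : ι → A) : Prop where
  star_eq : ∀ i, star (a i) = -a i
  mul_add_mul : ∀ i j, a i * a j + a j * a i = algebraMap ℝ A (-2 * inner ℝ (v i) (v j))

namespace IsSkewCliffordFamily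

variable {v : ι → Z} {a : ι → A}

theorem mul_self (h : IsSkewCliffordFamily v a) (i : ι) :
    a i * a i = algebraMap ℝ A (-‖v i‖ ^ 2) := by
  have h2 : (2 : ℝ) • (a i * a i) = (2 : ℝ) • algebraMap ℝ A (-‖v i‖ ^ 2) := by
    rw [two_smul, h.mul_add_mul, real_inner_self_eq_norm_sq, Algebra.smul_def, ← map_mul]
    ring_nf
  exact smul_right_injective A two_ne_zero h2

theorem norm_le [CStarRing A] (h : IsSkewCliffordFamily v a) (i : ι) : ‖a i‖ ≤ ‖v i‖ := by
  have hone : ‖(1 : A)‖ ≤ 1 := by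
    rcases subsingleton_or_nontrivial A with _ | _
    · simp [Subsingleton.elim (1 : A) 0]
    · exact CStarRing.norm_one.le
  have hsq : ‖a i‖ * ‖a i‖ ≤ ‖v i‖ * ‖v i‖ := by
    calc ‖a i‖ * ‖a i‖ = ‖star (a i) * a i‖ := CStarRing.norm_star_mul_self.symm
      _ = ‖v i‖ ^ 2 * ‖(1 : A)‖ := by
        rw [h.star_eq, neg_mul, h.mul_self, norm_neg, norm_algebraMap, norm_neg,
          Real.norm_of_nonneg (by positivity)]
      _ ≤ ‖v i‖ * ‖v i‖ := by nlinarith [sq_nonneg ‖v i‖]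
  exact abs_le_of_sq_le_sq' (by nlinarith) (norm_nonneg _) |>.2

theorem linearCombination [StarModule ℝ A] (h : IsSkewCliffordFamily v a) :
    IsSkewCliffordFamily (Finsupp.linearCombination ℝ v) (Finsupp.linearCombination ℝ a) where
  star_eq s := by
    simp only [Finsupp.linearCombination_apply, Finsupp.sum, star_sum, star_smul, star_trivial,
      h.star_eq, smul_neg, Finset.sum_neg_distrib]
  mul_add_mul s t := by
    let T := Finsupp.linearCombination ℝ a
    let E := Finsupp.linearCombination ℝ v
    let anticommutator := (LinearMap.mul ℝ A).compl₁₂ T T + ((LinearMap.mul ℝ A).compl₁₂ T T).flip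
    let scalar := (((innerₗ Z).compl₁₂ E E).compr₂ (LinearMap.lsmul ℝ ℝ (-2))).compr₂
      (Algebra.linearMap ℝ A)
    have hbasis : anticommutator = scalar := by
      ext i j
      simpa [anticommutator, scalar, T, E] using h.mul_add_mul i j
    simpa [anticommutator, scalar] using LinearMap.congr_fun₂ hbasis s t

theorem of_denseRange [CStarRing A] {X : ι → Z} {J : Z → A} (hJ : Continuous J) (hX : DenseRange X)
    (h : IsSkewCliffordFamily X (J ∘ X)) : IsSkewCliffordFamily id J where
  star_eq z := by
    refine hX.induction_on z (isClosed_eq ?_ ?_) h.star_eq <;> fun_prop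
  mul_add_mul z w := by
    refine hX.induction_on₂ (p := fun z w => J z * J w + J w * J z =
      algebraMap ℝ A (-2 * inner ℝ z w)) (isClosed_eq (by fun_prop) ?_) h.mul_add_mul z w
    exact (algebraMapCLM ℝ A).continuous.comp (by fun_prop)

theorem exists_extension [CStarRing A] [CompleteSpace A] [StarModule ℝ A]
    (h : IsSkewCliffordFamily v a)
    (hv : (Submodule.span ℝ (Set.range v)).topologicalClosure = ⊤) :
    ∃ J : Z →L[ℝ] A, (∀ i, J (v i) = a i) ∧ IsSkewCliffordFamily id J := by
  let T := Finsupp.linearCombination ℝ a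
  let E := Finsupp.linearCombination ℝ v
  have hE : DenseRange E := by
    rwa [DenseRange, ← LinearMap.coe_range, Finsupp.range_linearCombination,
      Submodule.dense_iff_topologicalClosure_eq_top]
  let J : Z →L[ℝ] A := T.extendOfNorm E
  have hJ : ∀ s, J (E s) = T s := T.extendOfNorm_eq hE
    ⟨1, fun s => (h.linearCombination.norm_le s).trans_eq (one_mul _).symm⟩
  refine ⟨J, fun i => ?_, of_denseRange J.continuous hE ?_⟩
  · simpa [E, T] using hJ (Finsupp.single i 1)
  · rw [show J ∘ E = T from funext hJ]
    exact h.linearCombination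

theorem of_orthonormal (hv : Orthonormal ℝ v)
    (hskew : ∀ i, star (a i) = -a i) (hsq : ∀ i, a i * a i = -1)
    (hanti : Pairwise fun i j => a i * a j = -(a j * a i)) : IsSkewCliffordFamily v a where
  star_eq := hskew
  mul_add_mul i j := by
    classical
    rw [orthonormal_iff_ite.1 hv i j]
    split_ifs with hij
    · subst hij
      rw [hsq, mul_one, map_neg, map_ofNat]
      norm_num
    · rw [hanti hij, mul_zero, map_zero, neg_add_cancel]

end IsSkewCliffordFamily

end CliffordExtension

section SkewRepresentations

variable {ι Z H : Type*} [NormedAddCommGroup Z] [InnerProductSpace ℝ Z]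
  [NormedAddCommGroup H] [InnerProductSpace ℂ H]

theorem negNormSq_apply (v : Z) : negNormSq Z v = -‖v‖ ^ 2 := by
  simp [negNormSq]

theorem clGen_mul_add_mul (v w : Z) :
    clGen v * clGen w + clGen w * clGen v = algebraMap ℝ (RealCl Z) (-2 * inner ℝ v w) := by
  rw [clGen, clGen, CliffordAlgebra.ι_mul_ι_add_swap, QuadraticMap.polar, negNormSq_apply,
    negNormSq_apply, negNormSq_apply, norm_add_sq_real]
  congr 1
  ring

/-- The restriction `a ↦ ρ (1 ⊗ a)` of a representation of `ℂ ⊗ C(Z)` to `C(Z)`. -/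
noncomputable def realAction (ρ : CplxCl Z →ₐ[ℂ] (H →L[ℂ] H)) : RealCl Z →ₐ[ℝ] (H →L[ℂ] H) :=
  (ρ.restrictScalars ℝ).comp Algebra.TensorProduct.includeRight

theorem realAction_mem_of_clGen_mem {ρ : CplxCl Z →ₐ[ℂ] (H →L[ℂ] H)}
    {S : Subalgebra ℝ (H →L[ℂ] H)} (hS : ∀ v, realAction ρ (clGen v) ∈ S) (a : RealCl Z) :
    realAction ρ a ∈ S := by
  have hgen : Algebra.adjoin ℝ (Set.range (CliffordAlgebra.ι (negNormSq Z))) ≤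
      S.comap (realAction ρ) :=
    Algebra.adjoin_le (Set.range_subset_iff.2 hS)
  rw [CliffordAlgebra.adjoin_range_ι] at hgen
  exact hgen trivial

variable [CompleteSpace H]

theorem IsSkewCliffordFamily.exists_isSkewRep {v : ι → Z} {a : ι → (H →L[ℂ] H)}
    (h : IsSkewCliffordFamily v a) (hv : (Submodule.span ℝ (Set.range v)).topologicalClosure = ⊤) :
    ∃ ρ : CplxCl Z →ₐ[ℂ] (H →L[ℂ] H), IsSkewRep ρ ∧ ∀ i, ρ (1 ⊗ₜ[ℝ] clGen (v i)) = a i := by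
  obtain ⟨J, hJv, hJ⟩ := h.exists_extension hv
  let g : RealCl Z →ₐ[ℝ] (H →L[ℂ] H) := CliffordAlgebra.lift (negNormSq Z)
    ⟨J.toLinearMap, fun w => by rw [negNormSq_apply]; exact hJ.mul_self w⟩
  let ρ := AlgHom.liftEquiv ℝ ℂ (RealCl Z) (H →L[ℂ] H) g
  have hρ : ∀ w, ρ (1 ⊗ₜ[ℝ] clGen w) = J w := fun w => by
    rw [AlgHom.liftEquiv_tmul, one_smul]
    exact CliffordAlgebra.lift_ι_apply _ _ w
  refine ⟨ρ, fun w => ?_, fun i => by rw [hρ, hJv]⟩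
  rw [hρ]
  exact hJ.star_eq w

namespace IsSkewRep

variable {ρ : CplxCl Z →ₐ[ℂ] (H →L[ℂ] H)}

theorem isSkewCliffordFamily (hρ : IsSkewRep ρ) :
    IsSkewCliffordFamily (id : Z → Z) fun w => realAction ρ (clGen w) where
  star_eq := hρ
  mul_add_mul w w' := by
    rw [← map_mul, ← map_mul, ← map_add, clGen_mul_add_mul, AlgHom.commutes, id, id]

/-- The action `w ↦ ρ (1 ⊗ w)` of `Z` under a skew representation, which is automatically
bounded. -/
noncomputable def clAction (hρ : IsSkewRep ρ) : Z →L[ℝ] (H →L[ℂ] H) :=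
  ((realAction ρ).toLinearMap.comp (CliffordAlgebra.ι (negNormSq Z))).mkContinuous 1 fun w =>
    (hρ.isSkewCliffordFamily.norm_le w).trans_eq (one_mul _).symm

theorem realAction_mem_of_isClosed (hρ : IsSkewRep ρ) {v : ι → Z}
    (hv : (Submodule.span ℝ (Set.range v)).topologicalClosure = ⊤)
    {S : Subalgebra ℝ (H →L[ℂ] H)} (hSc : IsClosed (S : Set (H →L[ℂ] H)))
    (hS : ∀ i, ρ (1 ⊗ₜ[ℝ] clGen (v i)) ∈ S) (a : RealCl Z) : realAction ρ a ∈ S := by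
  have hspan : (Submodule.span ℝ (Set.range v)).topologicalClosure ≤
      S.toSubmodule.comap hρ.clAction.toLinearMap :=
    Submodule.topologicalClosure_minimal _ (Submodule.span_le.2 (Set.range_subset_iff.2 hS))
      (hSc.preimage hρ.clAction.continuous)
  rw [hv] at hspan
  exact realAction_mem_of_clGen_mem (fun w => hspan trivial) a

theorem ext {ρ' : CplxCl Z →ₐ[ℂ] (H →L[ℂ] H)} (hρ : IsSkewRep ρ) (hρ' : IsSkewRep ρ') {v : ι → Z}
    (hv : (Submodule.span ℝ (Set.range v)).topologicalClosure = ⊤)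
    (h : ∀ i, ρ (1 ⊗ₜ[ℝ] clGen (v i)) = ρ' (1 ⊗ₜ[ℝ] clGen (v i))) : ρ = ρ' := by
  have hact : hρ.clAction = hρ'.clAction := ContinuousLinearMap.ext_on
    (Submodule.dense_iff_topologicalClosure_eq_top.2 hv) (Set.forall_mem_range.2 h)
  apply (AlgHom.liftEquiv ℝ ℂ (RealCl Z) (H →L[ℂ] H)).symm.injective
  exact CliffordAlgebra.hom_ext (LinearMap.ext fun w => DFunLike.congr_fun hact w)

end IsSkewRep

end SkewRepresentations

section Commutant

/-- Only scalars commute with all the operators `a i`. -/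
def HasTrivialCommutant {ι 𝕜 H : Type*} [NontriviallyNormedField 𝕜] [NormedAddCommGroup H]
    [NormedSpace 𝕜 H] (a : ι → H →L[𝕜] H) : Prop :=
  ∀ B : H →L[𝕜] H, (∀ i, Commute B (a i)) → ∃ c : 𝕜, B = c • 1

namespace HasTrivialCommutant

variable {ι : Type*}

theorem eq_bot_or_eq_top {𝕜 H : Type*} [RCLike 𝕜] [NormedAddCommGroup H] [InnerProductSpace 𝕜 H]
    [CompleteSpace H] {a : ι → H →L[𝕜] H} (ha : HasTrivialCommutant a)
    (hskew : ∀ i v w, inner 𝕜 (a i v) w = -inner 𝕜 v (a i w))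
    {U : Submodule 𝕜 H} (hU : IsClosed (U : Set H)) (hinv : ∀ i, ∀ v ∈ U, a i v ∈ U) :
    U = ⊥ ∨ U = ⊤ := by
  have : CompleteSpace U := hU.completeSpace_coe
  have horth : ∀ i, ∀ w ∈ Uᗮ, a i w ∈ Uᗮ := fun i w hw => by
    rw [Submodule.mem_orthogonal] at hw ⊢
    intro u hu
    rw [← neg_eq_zero, ← hskew, hw _ (hinv i u hu)]
  have hproj : ∀ i, Commute U.starProjection (a i) := fun i => by
    ext1 v
    refine Submodule.eq_starProjection_of_mem_orthogonal
      (hinv i _ (U.starProjection_apply_mem v)) ?_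
    change a i v - a i (U.starProjection v) ∈ Uᗮ
    rw [← map_sub]
    exact horth i _ (U.sub_starProjection_mem_orthogonal v)
  obtain ⟨c, hc⟩ := ha U.starProjection hproj
  rcases eq_or_ne c 0 with rfl | h0
  · refine .inl (eq_bot_iff.2 fun v hv => ?_)
    rw [← Submodule.starProjection_eq_self_iff, hc, zero_smul] at hv
    exact hv.symm
  · refine .inr (eq_top_iff.2 fun v _ => ?_)
    simpa [hc, smul_smul, h0] using U.starProjection_apply_mem (c⁻¹ • v)

theorem not_exists_intertwining_complex {F W : Type*} [NormedAddCommGroup F] [NormedSpace ℝ F]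
    [Nontrivial F] [NormedAddCommGroup W] [NormedSpace ℂ W] {a : ι → F →L[ℝ] F}
    (ha : HasTrivialCommutant a) (b : ι → W →L[ℂ] W) :
    ¬ ∃ φ : F ≃L[ℝ] W, ∀ i f, φ (a i f) = b i (φ f) := by
  rintro ⟨φ, hφ⟩
  let mulI : W →L[ℝ] W := (Complex.I • ContinuousLinearMap.id ℂ W).restrictScalars ℝ
  let j : F →L[ℝ] F := (φ.symm : W →L[ℝ] F) ∘L mulI ∘L (φ : F →L[ℝ] W)
  have hj : ∀ f, j f = φ.symm (Complex.I • φ f) := fun f => rfl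
  have hj_comm : ∀ i, Commute j (a i) := fun i => by
    ext f
    change j (a i f) = a i (j f)
    rw [hj, hφ, ← map_smul, hj, ContinuousLinearEquiv.symm_apply_eq, hφ, φ.apply_symm_apply]
  obtain ⟨r, hr⟩ := ha j hj_comm
  obtain ⟨f, hf⟩ := exists_ne (0 : F)
  have hjj : j (j f) = -f := by
    rw [hj, hj, φ.apply_symm_apply, smul_smul, Complex.I_mul_I, neg_one_smul, map_neg,
      φ.symm_apply_apply]
  have hrr : (r * r + 1) • f = 0 := by
    have hrf : r • r • f = -f := by simpa [hr] using hjj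
    rw [add_smul, one_smul, mul_smul, hrf, neg_add_cancel]
  rcases smul_eq_zero.1 hrr with h | h
  · nlinarith
  · exact hf h

end HasTrivialCommutant

end Commutant

section RealForm

section Complexify

variable {H E : Type*} [NormedAddCommGroup H] [NormedSpace ℂ H] [NormedSpace ℝ H]
  [IsScalarTower ℝ ℂ H] [NormedAddCommGroup E] [NormedSpace ℂ E] [NormedSpace ℝ E]
  [IsScalarTower ℝ ℂ E]

theorem complex_smul_eq (c : ℂ) (f : H) : c • f = c.re • f + c.im • Complex.I • f := by
  rw [← algebraMap_smul ℂ c.re f, ← algebraMap_smul ℂ c.im (Complex.I • f), smul_smul, ← add_smul]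
  congr 1
  exact (Complex.re_add_im c).symm

/-- The complex-linear map `f ↦ T f - i T (i f)` attached to a real-linear map `T`: twice its
complex-linear part. -/
noncomputable def complexify (T : H →L[ℝ] E) : H →L[ℂ] E where
  toFun f := T f - Complex.I • T (Complex.I • f)
  map_add' f g := by
    simp only [smul_add, map_add]
    abel
  map_smul' c f := by
    simp only [complex_smul_eq c, smul_add, map_add, map_smul, smul_smul Complex.I Complex.I,
      smul_comm Complex.I (_ : ℝ), Complex.I_mul_I, neg_one_smul, map_neg, RingHom.id_apply,
      smul_sub, smul_neg]
    abel
  cont := by fun_prop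

theorem complexify_apply (T : H →L[ℝ] E) (f : H) :
    complexify T f = T f - Complex.I • T (Complex.I • f) := rfl

end Complexify

/-- `F` is the real subspace fixed by the continuous conjugation `K` of the complex space `H`. -/
structure IsRealForm {H : Type*} [NormedAddCommGroup H] [NormedSpace ℂ H] [Module ℝ H]
    (K : H →L⋆[ℂ] H) (F : Submodule ℝ H) : Prop where
  involutive : Function.Involutive K
  mem_iff : ∀ {f}, f ∈ F ↔ K f = f

namespace IsRealForm

variable {ι H : Type*} [NormedAddCommGroup H] [NormedSpace ℂ H] [NormedSpace ℝ H]
  {K : H →L⋆[ℂ] H} {F : Submodule ℝ H}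

theorem isClosed (h : IsRealForm K F) : IsClosed (F : Set H) := by
  have hF : (F : Set H) = {f | K f = f} := Set.ext fun f => h.mem_iff
  rw [hF]
  exact isClosed_eq K.continuous continuous_id

/-- The real-linear projection `f ↦ (f + K f) / 2` onto the real form. -/
noncomputable def re (h : IsRealForm K F) : H →L[ℝ] F where
  toFun f := ⟨(2⁻¹ : ℝ) • (f + K f), by
    rw [h.mem_iff, map_real_smul K K.continuous, map_add, h.involutive, add_comm]⟩
  map_add' f g := by
    ext
    simp only [map_add, Submodule.coe_add]
    module
  map_smul' r f := by
    ext
    simp only [map_real_smul K K.continuous, SetLike.val_smul, RingHom.id_apply]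
    module
  cont := by fun_prop

theorem coe_re (h : IsRealForm K F) (f : H) : (h.re f : H) = (2⁻¹ : ℝ) • (f + K f) := rfl

theorem re_coe (h : IsRealForm K F) (u : F) : h.re u = u := by
  ext
  rw [coe_re, h.mem_iff.1 u.2]
  module

theorem re_I_smul_coe (h : IsRealForm K F) (u : F) : h.re (Complex.I • (u : H)) = 0 := by
  ext
  rw [coe_re, map_smulₛₗ, h.mem_iff.1 u.2, Complex.conj_I, neg_smul, add_neg_cancel, smul_zero,
    Submodule.coe_zero]

theorem nontrivial [Nontrivial H] (h : IsRealForm K F) : Nontrivial F := by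
  by_contra hF
  rw [not_nontrivial_iff_subsingleton] at hF
  obtain ⟨f, hf⟩ := exists_ne (0 : H)
  have hK : ∀ g, K g = -g := fun g => by
    have hre : (2⁻¹ : ℝ) • (g + K g) = 0 := congr_arg Subtype.val (Subsingleton.elim (h.re g) 0)
    exact eq_neg_of_add_eq_zero_right ((smul_eq_zero_iff_right (by norm_num)).1 hre)
  have hI : (2 * Complex.I) • f = 0 := by
    have hKI : K (Complex.I • f) = Complex.I • f := by
      rw [map_smulₛₗ, hK, Complex.conj_I, smul_neg, neg_smul, neg_neg]
    rw [mul_smul, two_smul, ← eq_neg_iff_add_eq_zero, ← hK, hKI]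
  exact hf ((smul_eq_zero_iff_right (by simp)).1 hI)

theorem re_apply_of_comm (h : IsRealForm K F) {T : H →L[ℂ] H} (hT : ∀ f, K (T f) = T (K f))
    {S : F →L[ℝ] F} (hS : ∀ u : F, (S u : H) = T u) (f : H) : h.re (T f) = S (h.re f) := by
  ext
  rw [hS, coe_re, coe_re, hT, map_real_smul T T.continuous, map_add]

theorem hasTrivialCommutant (h : IsRealForm K F) {a : ι → H →L[ℂ] H}
    (ha : HasTrivialCommutant a) (hK : ∀ i f, K (a i f) = a i (K f)) {b : ι → F →L[ℝ] F}
    (hb : ∀ i (u : F), (b i u : H) = a i u) : HasTrivialCommutant b := by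
  intro B hB
  let T : H →L[ℝ] H := F.subtypeL ∘L B ∘L h.re
  have hT_comm : ∀ i f, T (a i f) = a i (T f) := fun i f => by
    have hBu : B (b i (h.re f)) = b i (B (h.re f)) := DFunLike.congr_fun (hB i) (h.re f)
    change (B (h.re (a i f)) : H) = a i (B (h.re f))
    rw [h.re_apply_of_comm (hK i) (hb i), hBu, hb]
  obtain ⟨c, hc⟩ := ha (complexify T) fun i => by
    ext f
    change complexify T (a i f) = a i (complexify T f)
    rw [complexify_apply, complexify_apply, ← map_smul (a i), hT_comm, hT_comm, ← map_smul (a i),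
      ← map_sub]
  have hBc : ∀ u : F, (B u : H) = c • (u : H) := fun u => by
    have hu : (B (h.re u) : H) - Complex.I • (B (h.re (Complex.I • (u : H))) : H) = c • (u : H) :=
      DFunLike.congr_fun hc (u : H)
    simpa [h.re_coe, h.re_I_smul_coe] using hu
  refine ⟨c.re, ContinuousLinearMap.ext fun u => Subtype.ext ?_⟩
  have hconj : (B u : H) = conj c • (u : H) := by
    rw [← h.mem_iff.1 (B u).2, hBc, map_smulₛₗ, h.mem_iff.1 u.2]
  calc (B u : H) = (2⁻¹ : ℝ) • ((B u : H) + (B u : H)) := by module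
    _ = (2⁻¹ : ℝ) • (c + conj c) • (u : H) := by
      nth_rw 1 [hBc]
      rw [hconj, add_smul]
    _ = c.re • (u : H) := by
      rw [Complex.add_conj, ← algebraMap_smul ℂ (2⁻¹ : ℝ), ← algebraMap_smul ℂ c.re, smul_smul]
      simp

end IsRealForm

theorem real_inner_eq_re_complex_inner {H : Type*} [NormedAddCommGroup H] [InnerProductSpace ℂ H]
    [InnerProductSpace ℝ H] (v w : H) : inner ℝ v w = (inner ℂ v w).re := by
  rw [real_inner_eq_norm_add_mul_self_sub_norm_mul_self_sub_norm_mul_self_div_two]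
  exact (re_inner_eq_norm_add_mul_self_sub_norm_mul_self_sub_norm_mul_self_div_two
    (𝕜 := ℂ) v w).symm

end RealForm

section Ergodicity

theorem ae_eq_const_of_dense_closure_invariant {G X : Type*} [AddGroup G] [TopologicalSpace G]
    [IsTopologicalAddGroup G] [MeasurableSpace G] [BorelSpace G] [MeasurableAdd₂ G]
    {μ : Measure G} [IsFiniteMeasure μ] [μ.InnerRegular] [μ.IsAddLeftInvariant]
    [MeasurableSpace X] [Nonempty X] [MeasurableSpace.CountablySeparated X]
    {D : Set G} (hD : Dense (AddSubgroup.closure D : Set G)) {g : G → X} (hgm : NullMeasurable g μ)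
    (hg : ∀ d ∈ D, (fun x => g (d + x)) =ᵐ[μ] g) : ∃ c, g =ᵐ[μ] Function.const G c := by
  refine exists_eventuallyEq_const_of_forall_separating MeasurableSet fun U hU => ?_
  have hstab : AddSubgroup.closure D ≤ AddAction.aestabilizer G μ (g ⁻¹' U) := by
    refine (AddSubgroup.closure_le _).2 fun d hd => ?_
    rw [SetLike.mem_coe, ← neg_mem_iff, AddAction.mem_aestabilizer, ← Set.preimage_vadd]
    exact Eventually.set_eq ((hg d hd).mono fun x hx => iff_of_eq (congr_arg (· ∈ U) hx))
  have hconst : EventuallyConst (g ⁻¹' U) (ae μ) :=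
    aeconst_of_dense_aestabilizer_vadd (hgm hU) (hD.mono hstab)
  exact eventuallyConst_set.1 hconst

end Ergodicity

section MultiplicationOperators

variable {X : Type*} [MeasurableSpace X]

/-- The multiplication operator `f ↦ u f` on `L²(μ)`, as a bounded function of the multiplier
`u ∈ L^∞(μ)`. -/
noncomputable def mulOp (μ : Measure X) : Lp ℂ ∞ μ →L[ℂ] Lp ℂ 2 μ →L[ℂ] Lp ℂ 2 μ :=
  (ContinuousLinearMap.mul ℂ ℂ).holderL μ ∞ 2 2

theorem coeFn_mulOp (μ : Measure X) (u : Lp ℂ ∞ μ) (f : Lp ℂ 2 μ) :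
    mulOp μ u f =ᵐ[μ] fun x => u x * f x :=
  (ContinuousLinearMap.mul ℂ ℂ).coeFn_holder u f

variable [TopologicalSpace X] [CompactSpace X] [BorelSpace X] (μ : Measure X) [IsFiniteMeasure μ]

/-- The representation of continuous functions by multiplication operators on `L²(μ)`. -/
noncomputable def continuousMulOp : C(X, ℂ) →ₐ[ℂ] (Lp ℂ 2 μ →L[ℂ] Lp ℂ 2 μ) :=
  AlgHom.ofLinearMap ((mulOp μ).comp (ContinuousMap.toLp ∞ μ ℂ)).toLinearMap
    (by
      ext1 f
      refine Lp.ext ?_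
      filter_upwards [coeFn_mulOp μ (ContinuousMap.toLp ∞ μ ℂ 1) f,
        ContinuousMap.coeFn_toLp (p := ∞) (𝕜 := ℂ) μ (1 : C(X, ℂ))] with x hx h1
      exact hx.trans (by rw [h1]; exact one_mul _))
    (fun u v => by
      ext1 f
      refine Lp.ext ?_
      filter_upwards [coeFn_mulOp μ (ContinuousMap.toLp ∞ μ ℂ (u * v)) f,
        coeFn_mulOp μ (ContinuousMap.toLp ∞ μ ℂ u) (mulOp μ (ContinuousMap.toLp ∞ μ ℂ v) f),
        coeFn_mulOp μ (ContinuousMap.toLp ∞ μ ℂ v) f,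
        ContinuousMap.coeFn_toLp (p := ∞) (𝕜 := ℂ) μ u,
        ContinuousMap.coeFn_toLp (p := ∞) (𝕜 := ℂ) μ v,
        ContinuousMap.coeFn_toLp (p := ∞) (𝕜 := ℂ) μ (u * v)] with x huv hu hv eu ev euv
      refine huv.trans ((Eq.trans ?_ hu.symm))
      rw [hv, eu, ev, euv, ContinuousMap.mul_apply, mul_assoc])

theorem continuous_continuousMulOp : Continuous (continuousMulOp μ) :=
  ((mulOp μ).comp (ContinuousMap.toLp ∞ μ ℂ)).continuous

theorem coeFn_continuousMulOp (u : C(X, ℂ)) (f : Lp ℂ 2 μ) :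
    continuousMulOp μ u f =ᵐ[μ] fun x => u x * f x := by
  filter_upwards [coeFn_mulOp μ (ContinuousMap.toLp ∞ μ ℂ u) f,
    ContinuousMap.coeFn_toLp (p := ∞) (𝕜 := ℂ) μ u] with x hx hu
  exact hx.trans (by rw [hu])

theorem continuousMulOp_toLp (u v : C(X, ℂ)) : continuousMulOp μ u (ContinuousMap.toLp 2 μ ℂ v) =
    ContinuousMap.toLp 2 μ ℂ (u * v) := by
  refine Lp.ext ?_
  filter_upwards [coeFn_continuousMulOp μ u (ContinuousMap.toLp 2 μ ℂ v),
    ContinuousMap.coeFn_toLp (p := 2) (𝕜 := ℂ) μ v,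
    ContinuousMap.coeFn_toLp (p := 2) (𝕜 := ℂ) μ (u * v)] with x hx hv huv
  rw [hx, hv, huv, ContinuousMap.mul_apply]

variable {μ}

theorem commute_continuousMulOp_of_separating {ι : Type*} {u : ι → C(X, ℂ)}
    (hstar : ∀ i, star (u i) = u i) (hsep : ∀ x y, x ≠ y → ∃ i, u i x ≠ u i y)
    {B : Lp ℂ 2 μ →L[ℂ] Lp ℂ 2 μ} (hB : ∀ i, Commute B (continuousMulOp μ (u i))) (v : C(X, ℂ)) :
    Commute B (continuousMulOp μ v) := by
  let S : Subalgebra ℂ C(X, ℂ) := (Subalgebra.centralizer ℂ {B}).comap (continuousMulOp μ)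
  have hmem : ∀ {w}, w ∈ S ↔ B * continuousMulOp μ w = continuousMulOp μ w * B := by
    simp [S, Subalgebra.mem_centralizer_iff]
  have hS : IsClosed (S : Set C(X, ℂ)) := by
    have hcoe : (S : Set C(X, ℂ)) =
        {w | B * continuousMulOp μ w = continuousMulOp μ w * B} := Set.ext fun _ => hmem
    rw [hcoe]
    exact isClosed_eq (continuous_const.mul (continuous_continuousMulOp μ))
      ((continuous_continuousMulOp μ).mul continuous_const)
  have hdense := ContinuousMap.starSubalgebra_topologicalClosure_eq_top_of_separatesPoints
    (StarAlgebra.adjoin ℂ (Set.range u)) fun x y hxy =>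
      let ⟨i, hi⟩ := hsep x y hxy
      ⟨u i, ⟨u i, StarAlgebra.subset_adjoin ℂ _ ⟨i, rfl⟩, rfl⟩, hi⟩
  have hadjoin : (StarAlgebra.adjoin ℂ (Set.range u) : Set C(X, ℂ)) ⊆ S := by
    have hself : star (Set.range u) = Set.range u := by
      rw [← Set.image_star, ← Set.range_comp]
      exact congr_arg Set.range (funext hstar)
    rw [← StarSubalgebra.coe_toSubalgebra, StarAlgebra.adjoin_toSubalgebra, hself, Set.union_self]
    exact Algebra.adjoin_le (Set.range_subset_iff.2 fun i => hmem.2 (hB i))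
  refine hmem.1 (closure_minimal hadjoin hS ?_)
  rw [← StarSubalgebra.topologicalClosure_coe, hdense]
  trivial

theorem ae_eq_apply_one_mul [NormalSpace X] [μ.WeaklyRegular] {B : Lp ℂ 2 μ →L[ℂ] Lp ℂ 2 μ}
    (hB : ∀ u, Commute B (continuousMulOp μ u)) (f : Lp ℂ 2 μ) :
    B f =ᵐ[μ] fun x => B (ContinuousMap.toLp 2 μ ℂ 1) x * f x := by
  let b : Lp ℂ 2 μ := B (ContinuousMap.toLp 2 μ ℂ 1)
  let one : Lp ℂ 2 μ := ContinuousMap.toLp 2 μ ℂ (1 : C(X, ℂ))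
  let M := (ContinuousLinearMap.mul ℂ ℂ).holderL μ 2 2 1
  have hM : ∀ f g : Lp ℂ 2 μ, M f g =ᵐ[μ] fun x => f x * g x :=
    (ContinuousLinearMap.mul ℂ ℂ).coeFn_holder
  have hone : one =ᵐ[μ] 1 := ContinuousMap.coeFn_toLp (p := 2) (𝕜 := ℂ) μ (1 : C(X, ℂ))
  have hMB : M one ∘ B = M b := by
    refine (ContinuousMap.toLp_denseRange (p := 2) ℂ μ ℂ (by norm_num)).equalizer
      (by fun_prop) (by fun_prop) (funext fun u => Lp.ext ?_)
    have hBu : B (ContinuousMap.toLp 2 μ ℂ u) = continuousMulOp μ u b := by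
      have := DFunLike.congr_fun (hB u) one
      rwa [mul_apply_eq_comp, continuousMulOp_toLp, mul_one] at this
    filter_upwards [hM one (B (ContinuousMap.toLp 2 μ ℂ u)), hM b (ContinuousMap.toLp 2 μ ℂ u),
      hone, coeFn_continuousMulOp μ u b, ContinuousMap.coeFn_toLp (p := 2) (𝕜 := ℂ) μ u]
      with x h1 h2 h3 h4 h5
    rw [Function.comp_apply, Function.comp_apply, Function.comp_apply, h1, h2, h3, hBu, h4, h5,
      Pi.one_apply, one_mul, mul_comm]
  filter_upwards [hM one (B f), hM b f, hone] with x h1 h2 h3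
  rw [← h2, ← hMB, Function.comp_apply, h1, h3, Pi.one_apply, one_mul]

end MultiplicationOperators

section WeightedShift

variable {G : Type*} [AddGroup G] [MeasurableSpace G] [MeasurableAdd G]
  (μ : Measure G) [μ.IsAddRightInvariant]

theorem ae_comp_add_right {p : G → Prop} (d : G) (h : ∀ᵐ x ∂μ, p x) : ∀ᵐ x ∂μ, p (x + d) :=
  (measurePreserving_add_right μ d).quasiMeasurePreserving.ae h

/-- The operator `f ↦ u · f(· + d)` on `L²(G)`, for a bounded weight `u`. -/
noncomputable def weightedShift (d : G) (u : Lp ℂ ∞ μ) : Lp ℂ 2 μ →L[ℂ] Lp ℂ 2 μ :=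
  mulOp μ u ∘L (Lp.compMeasurePreservingₗᵢ ℂ (· + d)
    (measurePreserving_add_right μ d)).toContinuousLinearMap

theorem coeFn_weightedShift (d : G) (u : Lp ℂ ∞ μ) (f : Lp ℂ 2 μ) :
    weightedShift μ d u f =ᵐ[μ] fun x => u x * f (x + d) := by
  filter_upwards [coeFn_mulOp μ u (Lp.compMeasurePreservingₗᵢ ℂ (· + d)
      (measurePreserving_add_right μ d) f),
    Lp.coeFn_compMeasurePreserving f (measurePreserving_add_right μ d)] with x hu hf
  exact hu.trans (congr_arg (u x * ·) hf)

theorem adjoint_weightedShift {d : G} {u v : Lp ℂ ∞ μ} (huv : ∀ᵐ x ∂μ, conj (v (x + d)) = u x) :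
    ContinuousLinearMap.adjoint (weightedShift μ d u) = weightedShift μ (-d) v := by
  symm
  rw [ContinuousLinearMap.eq_adjoint_iff]
  intro f g
  rw [L2.inner_def, L2.inner_def, ← (measurePreserving_add_right μ d).integral_comp
    (MeasurableEquiv.addRight d).measurableEmbedding]
  refine integral_congr_ae ?_
  filter_upwards [coeFn_weightedShift μ d u g, huv,
    ae_comp_add_right μ d (coeFn_weightedShift μ (-d) v f)] with x hu hx hv
  rw [hu, hv, add_neg_cancel_right, RCLike.inner_apply, RCLike.inner_apply, map_mul, hx]
  ring

end WeightedShift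

section BinarySequences

theorem bitSign_zero : bitSign 0 = 1 := pow_zero _

theorem bitSign_one : bitSign 1 = -1 := pow_one _

theorem bitSign_add (a b : ZMod 2) : bitSign (a + b) = bitSign a * bitSign b := by
  rw [bitSign, bitSign, bitSign, ← pow_add, ZMod.val_add, ← neg_one_pow_eq_pow_mod_two]

theorem norm_bitSign (a : ZMod 2) : ‖bitSign a‖ = 1 := by
  rw [bitSign, norm_pow, norm_neg, norm_one, one_pow]

theorem conj_bitSign (a : ZMod 2) : conj (bitSign a) = bitSign a := by
  rw [bitSign, map_pow, map_neg, map_one]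

theorem bitSign_ne_zero (a : ZMod 2) : bitSign a ≠ 0 :=
  norm_ne_zero_iff.1 (norm_bitSign a ▸ one_ne_zero)

theorem bitSign_injective : Function.Injective bitSign := by
  intro a b h
  by_contra hab
  have hb : b = a + 1 := (by decide : ∀ a b : ZMod 2, a ≠ b → b = a + 1) a b hab
  rw [hb, bitSign_add, bitSign_one, mul_neg_one, self_eq_neg] at h
  exact bitSign_ne_zero a h

theorem bitSign_delta (j k : ℕ+) : bitSign (BinSeq.delta k j) = if j = k then -1 else 1 := by
  rw [BinSeq.delta, Pi.single_apply, apply_ite bitSign, bitSign_one, bitSign_zero]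

namespace BinSeq

theorem add_delta_add_delta (x : BinSeq) (k : ℕ+) : x + delta k + delta k = x := by
  rw [add_assoc, CharTwo.add_self_eq_zero, add_zero]

theorem one_sub_add (x y : BinSeq) : 1 - (x + y) = 1 - x + y := by
  rw [CharTwo.sub_eq_add, CharTwo.sub_eq_add, add_assoc]

theorem hasSum_piSingle (x : BinSeq) : HasSum (fun k => (Pi.single k (x k) : BinSeq)) x :=
  Pi.hasSum.2 fun k => by
    have hk := hasSum_single (f := fun j => (Pi.single j (x j) : BinSeq) k) k
      fun j hj => Pi.single_eq_of_ne' hj _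
    rwa [Pi.single_eq_same] at hk

theorem dense_closure_range_delta : Dense (AddSubgroup.closure (Set.range delta) : Set BinSeq) := by
  intro x
  refine mem_closure_of_tendsto (hasSum_piSingle x) (Eventually.of_forall fun s => ?_)
  refine sum_mem fun k _ => ?_
  have hk : (Pi.single k (x k) : BinSeq) = (x k).val • delta k := by
    rw [delta, ← Pi.single_smul, nsmul_one, ZMod.natCast_zmod_val]
  rw [hk]
  exact nsmul_mem (AddSubgroup.subset_closure (Set.mem_range_self k)) _

end BinSeq

/-- The Walsh function `x ↦ (-1)^(∑ x_j)`, `j ∈ S`: the continuous character of `{0,1}^ℕ` attached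
to a finite set `S` of positions. -/
noncomputable def walsh (S : Finset ℕ+) : C(BinSeq, ℂ) where
  toFun x := ∏ j ∈ S, bitSign (x j)
  continuous_toFun := continuous_finsetProd _ fun j _ =>
    (continuous_of_discreteTopology (f := bitSign)).comp (continuous_apply j)

theorem walsh_apply (S : Finset ℕ+) (x : BinSeq) : walsh S x = ∏ j ∈ S, bitSign (x j) := rfl

theorem walsh_singleton_apply (k : ℕ+) (x : BinSeq) : walsh {k} x = bitSign (x k) :=
  Finset.prod_singleton _ _

theorem walsh_apply_eq_pow (S : Finset ℕ+) (x : BinSeq) :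
    walsh S x = (-1) ^ ∑ j ∈ S, (x j).val :=
  Finset.prod_pow_eq_pow_sum _ _ _

theorem walsh_add (S : Finset ℕ+) (x y : BinSeq) : walsh S (x + y) = walsh S x * walsh S y := by
  simp only [walsh_apply, Pi.add_apply, bitSign_add, Finset.prod_mul_distrib]

theorem walsh_one (S : Finset ℕ+) : walsh S 1 = (-1) ^ S.card := by
  simp only [walsh_apply, Pi.one_apply, bitSign_one, Finset.prod_const]

theorem walsh_delta (S : Finset ℕ+) (k : ℕ+) :
    walsh S (BinSeq.delta k) = if k ∈ S then -1 else 1 := by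
  simp only [walsh_apply, bitSign_delta, Finset.prod_ite_eq']

theorem norm_walsh (S : Finset ℕ+) (x : BinSeq) : ‖walsh S x‖ = 1 := by
  rw [walsh_apply, norm_prod, Finset.prod_eq_one fun j _ => norm_bitSign _]

theorem conj_walsh (S : Finset ℕ+) (x : BinSeq) : conj (walsh S x) = walsh S x := by
  simp only [walsh_apply, map_prod, conj_bitSign]

theorem star_walsh (S : Finset ℕ+) : star (walsh S) = walsh S :=
  ContinuousMap.ext (conj_walsh S)

theorem exists_walsh_singleton_ne {x y : BinSeq} (hxy : x ≠ y) :
    ∃ k, walsh {k} x ≠ walsh {k} y := by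
  obtain ⟨k, hk⟩ := Function.ne_iff.1 hxy
  refine ⟨k, ?_⟩
  rw [walsh_singleton_apply, walsh_singleton_apply]
  exact bitSign_injective.ne hk

theorem walsh_Iic (k : ℕ+) (x : BinSeq) :
    walsh (Finset.Iic k) x = bitSign (x k) * walsh (Finset.Iio k) x := by
  rw [walsh_apply, walsh_apply, ← Finset.Iio_insert, Finset.prod_insert (by simp)]

end BinarySequences

section SplitCoeff

theorem measurable_bitSign : Measurable bitSign := measurable_of_finite _

theorem splitCoeff_add (k : ℕ+) (x y : BinSeq) :
    splitCoeff k (x + y) = splitCoeff k x * splitCoeff k y := by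
  simp only [splitCoeff]
  split_ifs
  · exact bitSign_add _ _
  · exact bitSign_add _ _
  · exact (one_mul 1).symm

theorem norm_splitCoeff (k : ℕ+) (x : BinSeq) : ‖splitCoeff k x‖ = 1 := by
  simp only [splitCoeff]
  split_ifs
  exacts [norm_bitSign _, norm_bitSign _, norm_one]

theorem conj_splitCoeff (k : ℕ+) (x : BinSeq) : conj (splitCoeff k x) = splitCoeff k x := by
  simp only [splitCoeff]
  split_ifs
  exacts [conj_bitSign _, conj_bitSign _, map_one _]

theorem measurable_splitCoeff (k : ℕ+) : Measurable (splitCoeff k) := by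
  unfold splitCoeff
  split_ifs
  · exact measurable_bitSign.comp (measurable_pi_apply _)
  · exact measurable_bitSign.comp (measurable_pi_apply _)
  · exact measurable_const

theorem splitCoeff_one (k : ℕ+) : splitCoeff k 1 = (-1) ^ (k : ℕ) := by
  simp only [splitCoeff, Pi.one_apply, bitSign_one]
  split_ifs with h1 h3
  · exact (Odd.neg_one_pow (Nat.odd_iff.2 (by omega))).symm
  · exact (Odd.neg_one_pow (Nat.odd_iff.2 (by omega))).symm
  · exact (Even.neg_one_pow (Nat.even_iff.2 (by omega))).symm

/-- The matching `4ℓ+1 ↔ 4ℓ+3` of the odd positions: `c_k` depends exactly on the position matched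
with `k`. -/
def SplitPartner (k l : ℕ+) : Prop :=
  ((k : ℕ) % 4 = 1 ∧ (l : ℕ) = k + 2) ∨ ((l : ℕ) % 4 = 1 ∧ (k : ℕ) = l + 2)

theorem splitPartner_comm {k l : ℕ+} : SplitPartner k l ↔ SplitPartner l k := or_comm

theorem not_splitPartner_self (k : ℕ+) : ¬ SplitPartner k k := by
  unfold SplitPartner
  omega

open Classical in
theorem splitCoeff_delta (k l : ℕ+) :
    splitCoeff k (BinSeq.delta l) = if SplitPartner k l then -1 else 1 := by
  have hsub : (k : ℕ) % 4 = 3 → ((k - 2 : ℕ+) : ℕ) = k - 2 := fun h => by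
    rw [PNat.sub_coe, if_pos (PNat.coe_lt_coe _ _ |>.1 (by change 2 < (k : ℕ); omega))]
    rfl
  have h2 : ((2 : ℕ+) : ℕ) = 2 := rfl
  simp only [splitCoeff, bitSign_delta, SplitPartner, ← PNat.coe_inj, PNat.add_coe, h2]
  grind

theorem isGWCoeff_splitCoeff : IsGWCoeff splitCoeff where
  measurable := measurable_splitCoeff
  norm_eq_one := norm_splitCoeff
  conj_eq k x := by
    rw [conj_splitCoeff, splitCoeff_add, splitCoeff_delta, if_neg (not_splitPartner_self k),
      mul_one]
  cocycle k l x := by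
    rw [splitCoeff_add, splitCoeff_add, splitCoeff_delta, splitCoeff_delta, splitPartner_comm]
    ring

theorem conj_splitCoeff_one_sub (k : ℕ+) (x : BinSeq) :
    conj (splitCoeff k (1 - x)) = (-1) ^ (k : ℕ) * splitCoeff k x := by
  rw [conj_splitCoeff, CharTwo.sub_eq_add, splitCoeff_add, splitCoeff_one]

end SplitCoeff

section Weights

/-- The position flipped by the operator of a real basis vector of `Z`. -/
def flipIndex : ℕ+ ⊕ ℕ+ → ℕ+ := Sum.elim id id

/-- The set of positions whose parity enters the weight of the operator of a real basis vector. -/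
def signSupport : ℕ+ ⊕ ℕ+ → Finset ℕ+ := Sum.elim Finset.Iio Finset.Iic

/-- The constant phase in the weight of the operator of a real basis vector. -/
def phase : ℕ+ ⊕ ℕ+ → ℂ := Sum.elim (fun _ => -Complex.I) (fun _ => 1)

/-- The weight of the Gårding-Wightman operator of `z_k` (index `inl k`) or `σ(z_k)` (index
`inr k`), as a phase times a character times the coefficient `c_k`. -/
noncomputable def gwWeight (c : ℕ+ → BinSeq → ℂ) (t : ℕ+ ⊕ ℕ+) (x : BinSeq) : ℂ :=
  phase t * walsh (signSupport t) x * c (flipIndex t) x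

theorem gwWeight_inl (c : ℕ+ → BinSeq → ℂ) (k : ℕ+) (x : BinSeq) : gwWeight c (.inl k) x =
    (-1) ^ ((∑ j ∈ Finset.Iio k, (x j).val) + 1) * Complex.I * c k x := by
  rw [pow_succ, ← walsh_apply_eq_pow]
  simp only [gwWeight, phase, signSupport, flipIndex, Sum.elim_inl, id]
  ring

theorem gwWeight_inr (c : ℕ+ → BinSeq → ℂ) (k : ℕ+) (x : BinSeq) :
    gwWeight c (.inr k) x = bitSign (x k) * Complex.I * gwWeight c (.inl k) x := by
  simp only [gwWeight, phase, signSupport, flipIndex, Sum.elim_inl, Sum.elim_inr, id, walsh_Iic]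
  linear_combination (bitSign (x k) * walsh (Finset.Iio k) x * c k x) * Complex.I_mul_I

theorem norm_phase (t : ℕ+ ⊕ ℕ+) : ‖phase t‖ = 1 := by
  rcases t with k | k <;> simp [phase]

theorem conj_phase_mul_walsh_delta (t : ℕ+ ⊕ ℕ+) :
    conj (phase t) * walsh (signSupport t) (BinSeq.delta (flipIndex t)) = -phase t := by
  rcases t with k | k <;> simp [phase, signSupport, flipIndex, walsh_delta]

theorem conj_phase_mul_walsh_one (t : ℕ+ ⊕ ℕ+) :
    conj (phase t) * walsh (signSupport t) 1 = (-1) ^ (flipIndex t : ℕ) * phase t := by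
  rcases t with k | k
  · obtain ⟨n, hn⟩ := Nat.exists_eq_add_of_lt k.pos
    have hcard : (Finset.Iio k).card = n := by
      rw [← Finset.Ico_bot, PNat.card_Ico, PNat.bot_eq_one, PNat.one_coe]
      omega
    have hk : (k : ℕ) = n + 1 := by omega
    simp only [phase, signSupport, flipIndex, Sum.elim_inl, id, walsh_one, hcard, hk, map_neg,
      Complex.conj_I]
    ring
  · have hcard : (Finset.Iic k).card = k := by
      rw [← Finset.Icc_bot, PNat.card_Icc, PNat.bot_eq_one, PNat.one_coe]
      omega
    simp only [phase, signSupport, flipIndex, Sum.elim_inr, id, walsh_one, hcard, map_one, one_mul,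
      mul_one]

theorem walsh_delta_antisymm {s t : ℕ+ ⊕ ℕ+} (hst : s ≠ t) :
    walsh (signSupport t) (BinSeq.delta (flipIndex s)) =
      -walsh (signSupport s) (BinSeq.delta (flipIndex t)) := by
  rw [walsh_delta, walsh_delta]
  rcases s with k | k <;> rcases t with l | l <;>
    simp only [signSupport, flipIndex, Sum.elim_inl, Sum.elim_inr, id, Finset.mem_Iio,
      Finset.mem_Iic] <;> grind

variable {c : ℕ+ → BinSeq → ℂ}

theorem conj_gwWeight_one_sub (hc : ∀ k x, conj (c k (1 - x)) = (-1) ^ (k : ℕ) * c k x)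
    (t : ℕ+ ⊕ ℕ+) (x : BinSeq) : conj (gwWeight c t (1 - x)) = gwWeight c t x := by
  have hsign : ((-1 : ℂ) ^ (flipIndex t : ℕ)) * (-1) ^ (flipIndex t : ℕ) = 1 := by
    rw [← mul_pow, neg_one_mul, neg_neg, one_pow]
  rw [gwWeight, map_mul, map_mul, conj_walsh, hc, CharTwo.sub_eq_add, walsh_add, gwWeight]
  linear_combination
    (walsh (signSupport t) x * (-1) ^ (flipIndex t : ℕ) * c (flipIndex t) x) *
      conj_phase_mul_walsh_one t + (phase t * walsh (signSupport t) x * c (flipIndex t) x) * hsign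

namespace IsGWCoeff

variable (hc : IsGWCoeff c)
include hc

theorem measurable_gwWeight (t : ℕ+ ⊕ ℕ+) : Measurable (gwWeight c t) :=
  (measurable_const.mul (walsh _).continuous.measurable).mul (hc.measurable _)

theorem norm_gwWeight (t : ℕ+ ⊕ ℕ+) (x : BinSeq) : ‖gwWeight c t x‖ = 1 := by
  rw [gwWeight, norm_mul, norm_mul, norm_phase, norm_walsh, hc.norm_eq_one, one_mul, one_mul]

theorem conj_gwWeight_add_delta (t : ℕ+ ⊕ ℕ+) (x : BinSeq) :
    conj (gwWeight c t (x + BinSeq.delta (flipIndex t))) = -gwWeight c t x := by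
  rw [gwWeight, map_mul, map_mul, conj_walsh, hc.conj_eq, BinSeq.add_delta_add_delta, walsh_add,
    gwWeight]
  linear_combination (walsh (signSupport t) x * c (flipIndex t) x) * conj_phase_mul_walsh_delta t

theorem gwWeight_mul_gwWeight_add_delta (t : ℕ+ ⊕ ℕ+) (x : BinSeq) :
    gwWeight c t x * gwWeight c t (x + BinSeq.delta (flipIndex t)) = -1 := by
  rw [← Complex.conj_conj (gwWeight c t (x + _)), hc.conj_gwWeight_add_delta, map_neg, mul_neg,
    Complex.mul_conj', hc.norm_gwWeight, Complex.ofReal_one, one_pow]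

theorem gwWeight_anticomm {s t : ℕ+ ⊕ ℕ+} (hst : s ≠ t) (x : BinSeq) :
    gwWeight c s x * gwWeight c t (x + BinSeq.delta (flipIndex s)) =
      -(gwWeight c t x * gwWeight c s (x + BinSeq.delta (flipIndex t))) := by
  simp only [gwWeight, walsh_add, walsh_delta_antisymm hst]
  linear_combination (-phase s * phase t * walsh (signSupport s) x * walsh (signSupport t) x *
    walsh (signSupport s) (BinSeq.delta (flipIndex t))) * hc.cocycle (flipIndex s) (flipIndex t) x

end IsGWCoeff

end Weights

section BasisOperators

variable {c : ℕ+ → BinSeq → ℂ} (hc : IsGWCoeff c) (μ : Measure BinSeq)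

namespace IsGWCoeff

/-- The weight of the Gårding-Wightman operator of a real basis vector, as an element of
`L^∞(X)`. -/
noncomputable def weightLp (t : ℕ+ ⊕ ℕ+) : Lp ℂ ∞ μ :=
  MemLp.toLp (gwWeight c t) <|
    memLp_top_of_bound (hc.measurable_gwWeight t).aestronglyMeasurable 1 <|
      Eventually.of_forall fun x => (hc.norm_gwWeight t x).le

theorem coeFn_weightLp (t : ℕ+ ⊕ ℕ+) : hc.weightLp μ t =ᵐ[μ] gwWeight c t := MemLp.coeFn_toLp _

variable [μ.IsAddHaarMeasure]

/-- The Gårding-Wightman operator on `L²(X)` attached to the basis vector `z_k` (index `inl k`) or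
`σ(z_k)` (index `inr k`). -/
noncomputable def gwOp (t : ℕ+ ⊕ ℕ+) : Lp ℂ 2 μ →L[ℂ] Lp ℂ 2 μ :=
  weightedShift μ (BinSeq.delta (flipIndex t)) (hc.weightLp μ t)

theorem coeFn_gwOp (t : ℕ+ ⊕ ℕ+) (f : Lp ℂ 2 μ) :
    hc.gwOp μ t f =ᵐ[μ] fun x => gwWeight c t x * f (x + BinSeq.delta (flipIndex t)) := by
  filter_upwards [coeFn_weightedShift μ (BinSeq.delta (flipIndex t)) (hc.weightLp μ t) f,
    hc.coeFn_weightLp μ t] with x hx hw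
  exact hx.trans (by rw [hw])

theorem coeFn_gwOp_mul_gwOp (s t : ℕ+ ⊕ ℕ+) (f : Lp ℂ 2 μ) :
    (hc.gwOp μ s * hc.gwOp μ t) f =ᵐ[μ] fun x =>
      gwWeight c s x * gwWeight c t (x + BinSeq.delta (flipIndex s)) *
        f (x + BinSeq.delta (flipIndex s) + BinSeq.delta (flipIndex t)) := by
  filter_upwards [hc.coeFn_gwOp μ s (hc.gwOp μ t f),
    ae_comp_add_right μ (BinSeq.delta (flipIndex s)) (hc.coeFn_gwOp μ t f)] with x hs ht
  rw [mul_apply_eq_comp, hs, ht, mul_assoc]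

theorem adjoint_gwOp (t : ℕ+ ⊕ ℕ+) :
    ContinuousLinearMap.adjoint (hc.gwOp μ t) = -hc.gwOp μ t := by
  rw [gwOp, adjoint_weightedShift μ (v := -hc.weightLp μ t), CharTwo.neg_eq]
  · simp only [weightedShift, map_neg, ContinuousLinearMap.neg_comp]
  · filter_upwards [hc.coeFn_weightLp μ t,
      ae_comp_add_right μ (BinSeq.delta (flipIndex t)) (hc.coeFn_weightLp μ t),
      ae_comp_add_right μ (BinSeq.delta (flipIndex t)) (Lp.coeFn_neg (hc.weightLp μ t))]
      with x hx hd hn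
    rw [hn, Pi.neg_apply, hd, hx, map_neg, hc.conj_gwWeight_add_delta, neg_neg]

theorem gwOp_mul_self (t : ℕ+ ⊕ ℕ+) : hc.gwOp μ t * hc.gwOp μ t = -1 := by
  ext1 f
  refine Lp.ext ?_
  filter_upwards [hc.coeFn_gwOp_mul_gwOp μ t t f, Lp.coeFn_neg f] with x hx hn
  rw [hx, hc.gwWeight_mul_gwWeight_add_delta, BinSeq.add_delta_add_delta, neg_one_mul]
  exact hn.symm

theorem gwOp_anticomm {s t : ℕ+ ⊕ ℕ+} (hst : s ≠ t) :
    hc.gwOp μ s * hc.gwOp μ t = -(hc.gwOp μ t * hc.gwOp μ s) := by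
  ext1 f
  refine Lp.ext ?_
  filter_upwards [hc.coeFn_gwOp_mul_gwOp μ s t f, hc.coeFn_gwOp_mul_gwOp μ t s f,
    Lp.coeFn_neg ((hc.gwOp μ t * hc.gwOp μ s) f)] with x hs ht hn
  rw [hs, hc.gwWeight_anticomm hst, add_right_comm, neg_mul, ← ht]
  exact hn.symm

theorem isSkewCliffordFamily_gwOp {Z : Type*} [NormedAddCommGroup Z] [InnerProductSpace ℝ Z]
    {v : ℕ+ ⊕ ℕ+ → Z} (hv : Orthonormal ℝ v) : IsSkewCliffordFamily v (hc.gwOp μ) :=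
  .of_orthonormal hv (hc.adjoint_gwOp μ) (hc.gwOp_mul_self μ) fun _ _ => hc.gwOp_anticomm μ

theorem continuousMulOp_walsh_singleton (k : ℕ+) : continuousMulOp μ (walsh {k}) =
    Complex.I • (hc.gwOp μ (.inr k) * hc.gwOp μ (.inl k)) := by
  ext1 f
  refine Lp.ext ?_
  filter_upwards [coeFn_continuousMulOp μ (walsh {k}) f,
    Lp.coeFn_smul Complex.I ((hc.gwOp μ (.inr k) * hc.gwOp μ (.inl k)) f),
    hc.coeFn_gwOp_mul_gwOp μ (.inr k) (.inl k) f] with x hx hI hmul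
  have hsq := hc.gwWeight_mul_gwWeight_add_delta (.inl k) x
  simp only [flipIndex, Sum.elim_inl, Sum.elim_inr, id, BinSeq.add_delta_add_delta] at hmul hsq
  rw [hx, walsh_singleton_apply]
  refine Eq.trans ?_ hI.symm
  rw [Pi.smul_apply, hmul, gwWeight_inr, smul_eq_mul]
  linear_combination (bitSign (x k) * f x) * Complex.I_mul_I -
    (Complex.I * Complex.I * bitSign (x k) * f x) * hsq

theorem ae_eq_const_of_commute_gwOp {B : Lp ℂ 2 μ →L[ℂ] Lp ℂ 2 μ}
    (hB : ∀ t, Commute B (hc.gwOp μ t))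
    (hmul : ∀ f, B f =ᵐ[μ] fun x => B (ContinuousMap.toLp 2 μ ℂ 1) x * f x) :
    ∃ b, B (ContinuousMap.toLp 2 μ ℂ 1) =ᵐ[μ] Function.const BinSeq b := by
  refine ae_eq_const_of_dense_closure_invariant BinSeq.dense_closure_range_delta
    (Lp.aestronglyMeasurable _).aemeasurable.nullMeasurable (Set.forall_mem_range.2 fun k => ?_)
  let one : Lp ℂ 2 μ := ContinuousMap.toLp 2 μ ℂ (1 : C(BinSeq, ℂ))
  have hone : one =ᵐ[μ] 1 := ContinuousMap.coeFn_toLp (p := 2) (𝕜 := ℂ) μ (1 : C(BinSeq, ℂ))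
  have hcomm : B (hc.gwOp μ (.inl k) one) = hc.gwOp μ (.inl k) (B one) :=
    DFunLike.congr_fun (hB (.inl k)) one
  have hleft := hmul (hc.gwOp μ (.inl k) one)
  rw [hcomm] at hleft
  filter_upwards [hleft, hc.coeFn_gwOp μ (.inl k) (B one), hc.coeFn_gwOp μ (.inl k) one,
    ae_comp_add_right μ (BinSeq.delta (flipIndex (.inl k))) hone] with x h1 h2 h3 h4
  have hne : gwWeight c (.inl k) x ≠ 0 :=
    norm_ne_zero_iff.1 (hc.norm_gwWeight (.inl k) x ▸ one_ne_zero)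
  rw [h2, h3, h4, Pi.one_apply, mul_one, mul_comm] at h1
  rw [add_comm]
  exact mul_right_cancel₀ hne h1

theorem hasTrivialCommutant_gwOp : HasTrivialCommutant (hc.gwOp μ) := by
  intro B hB
  have hwalsh : ∀ k, Commute B (continuousMulOp μ (walsh {k})) := fun k => by
    rw [hc.continuousMulOp_walsh_singleton]
    exact ((hB _).mul_right (hB _)).smul_right _
  have hmul := ae_eq_apply_one_mul (commute_continuousMulOp_of_separating
    (fun k => star_walsh {k}) (fun _ _ => exists_walsh_singleton_ne) hwalsh)
  obtain ⟨b, hb⟩ := hc.ae_eq_const_of_commute_gwOp μ hB hmul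
  refine ⟨b, ContinuousLinearMap.ext fun f => Lp.ext ?_⟩
  filter_upwards [hmul f, hb, Lp.coeFn_smul b f] with x hx hbx hs
  rw [hx, hbx]
  exact hs.symm

theorem gwOp_inl_ae_eq_gwFormula (k : ℕ+) (f : Lp ℂ 2 μ) :
    hc.gwOp μ (.inl k) f =ᵐ[μ] gwFormula μ c k f := by
  filter_upwards [hc.coeFn_gwOp μ (.inl k) f, Measure.rnDeriv_self μ] with x hx hd
  rw [hx, gwFormula, (measurePreserving_add_right μ _).map_eq, hd, ENNReal.toReal_one,
    Real.sqrt_one, Complex.ofReal_one, mul_one, gwWeight_inl]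
  rfl

theorem gwOp_inr_ae_eq (k : ℕ+) (f : Lp ℂ 2 μ) : hc.gwOp μ (.inr k) f =ᵐ[μ]
    fun x => bitSign (x k) * Complex.I * hc.gwOp μ (.inl k) f x := by
  filter_upwards [hc.coeFn_gwOp μ (.inl k) f, hc.coeFn_gwOp μ (.inr k) f] with x hl hr
  rw [hl, hr, gwWeight_inr, mul_assoc _ (gwWeight c _ x)]
  rfl

theorem isGWRep_iff {Z : Type*} [NormedAddCommGroup Z] [InnerProductSpace ℝ Z]
    {σ : Z →ₗᵢ[ℝ] Z} {z : ℕ+ → Z} {ρ : CplxCl Z →ₐ[ℂ] (Lp ℂ 2 μ →L[ℂ] Lp ℂ 2 μ)} :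
    IsGWRep σ z μ c ρ ↔ IsSkewRep ρ ∧
      ∀ t, ρ (1 ⊗ₜ[ℝ] clGen (Sum.elim z (fun k => σ (z k)) t)) = hc.gwOp μ t := by
  constructor
  · intro h
    have hl : ∀ k, ρ (1 ⊗ₜ[ℝ] clGen (z k)) = hc.gwOp μ (.inl k) := fun k =>
      ContinuousLinearMap.ext fun f =>
        Lp.ext ((h.apply_basis k f).trans (hc.gwOp_inl_ae_eq_gwFormula μ k f).symm)
    refine ⟨h.skew, Sum.forall.2 ⟨hl, fun k => ContinuousLinearMap.ext fun f => Lp.ext ?_⟩⟩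
    have hr := h.apply_sigma_basis k f
    rw [hl] at hr
    exact hr.trans (hc.gwOp_inr_ae_eq μ k f).symm
  · rintro ⟨hskew, h⟩
    have hl : ∀ k, ρ (1 ⊗ₜ[ℝ] clGen (z k)) = hc.gwOp μ (.inl k) := fun k => h (.inl k)
    have hr : ∀ k, ρ (1 ⊗ₜ[ℝ] clGen (σ (z k))) = hc.gwOp μ (.inr k) := fun k => h (.inr k)
    refine ⟨hskew, fun k f => ?_, fun k f => ?_⟩
    · rw [hl]
      exact hc.gwOp_inl_ae_eq_gwFormula μ k f
    · rw [hl, hr]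
      exact hc.gwOp_inr_ae_eq μ k f

end IsGWCoeff

end BasisOperators

section ConjReflect

variable (μ : Measure BinSeq) [μ.IsAddHaarMeasure]

theorem ae_comp_one_sub {p : BinSeq → Prop} (h : ∀ᵐ x ∂μ, p x) : ∀ᵐ x ∂μ, p (1 - x) :=
  (BinSeq.quasiMeasurePreserving_one_sub μ).ae h

/-- The conjugation `f ↦ conj (f (1 - ·))` of `L²(X)`, whose fixed vectors are the real form. -/
noncomputable def conjReflect : Lp ℂ 2 μ →L⋆[ℂ] Lp ℂ 2 μ :=
  ((starL ℂ : ℂ ≃L⋆[ℂ] ℂ) : ℂ →L⋆[ℂ] ℂ).compLpL 2 μ ∘SL (Lp.compMeasurePreservingₗᵢ ℂ (1 - ·)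
    (Measure.measurePreserving_sub_left μ (1 : BinSeq))).toContinuousLinearMap

theorem coeFn_conjReflect (f : Lp ℂ 2 μ) : conjReflect μ f =ᵐ[μ] fun x => conj (f (1 - x)) := by
  have hsub := Measure.measurePreserving_sub_left μ (1 : BinSeq)
  filter_upwards [ContinuousLinearMap.coeFn_compLpL ((starL ℂ : ℂ ≃L⋆[ℂ] ℂ) : ℂ →L⋆[ℂ] ℂ)
    (Lp.compMeasurePreservingₗᵢ ℂ (1 - ·) hsub f),
    Lp.coeFn_compMeasurePreserving f hsub] with x hstar hx
  exact hstar.trans (congr_arg conj hx)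

theorem isRealForm_conjReflect : IsRealForm (conjReflect μ) (realForm μ) where
  involutive f := by
    refine Lp.ext ?_
    filter_upwards [coeFn_conjReflect μ (conjReflect μ f),
      ae_comp_one_sub μ (coeFn_conjReflect μ f)] with x h1 h2
    rw [h1, h2, Complex.conj_conj, sub_sub_cancel]
  mem_iff {f} := by
    have hf : f ∈ realForm μ ↔ ∀ᵐ x ∂μ, f (1 - x) = conj (f x) := Iff.rfl
    rw [hf, Lp.ext_iff]
    refine eventually_congr ((coeFn_conjReflect μ f).mono fun x hx => ?_)
    rw [hx, ← (starRingEnd ℂ).injective.eq_iff, Complex.conj_conj]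

theorem IsGWCoeff.conjReflect_gwOp {c : ℕ+ → BinSeq → ℂ} (hc : IsGWCoeff c)
    (hc_refl : ∀ k x, conj (c k (1 - x)) = (-1) ^ (k : ℕ) * c k x) (t : ℕ+ ⊕ ℕ+) (f : Lp ℂ 2 μ) :
    conjReflect μ (hc.gwOp μ t f) = hc.gwOp μ t (conjReflect μ f) := by
  refine Lp.ext ?_
  filter_upwards [coeFn_conjReflect μ (hc.gwOp μ t f),
    ae_comp_one_sub μ (hc.coeFn_gwOp μ t f), hc.coeFn_gwOp μ t (conjReflect μ f),
    ae_comp_add_right μ (BinSeq.delta (flipIndex t)) (coeFn_conjReflect μ f)] with x h1 h2 h3 h4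
  rw [h1, h2, h3, h4, map_mul, conj_gwWeight_one_sub hc_refl, BinSeq.one_sub_add]

end ConjReflect

section Irreducibility

variable {ι Z H : Type*} [NormedAddCommGroup Z] [InnerProductSpace ℝ Z]
  [NormedAddCommGroup H] [InnerProductSpace ℂ H]

theorem IsSkewRep.comm_realAction [CompleteSpace H] {ρ : CplxCl Z →ₐ[ℂ] (H →L[ℂ] H)}
    (hρ : IsSkewRep ρ) {v : ι → Z}
    (hv : (Submodule.span ℝ (Set.range v)).topologicalClosure = ⊤) {K : H →L⋆[ℂ] H}
    (hK : ∀ i f, K (ρ (1 ⊗ₜ[ℝ] clGen (v i)) f) = ρ (1 ⊗ₜ[ℝ] clGen (v i)) (K f))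
    (a : RealCl Z) (f : H) : K (realAction ρ a f) = realAction ρ a (K f) := by
  let S : Subalgebra ℝ (H →L[ℂ] H) :=
    { carrier := {T | ∀ f, K (T f) = T (K f)}
      mul_mem' := fun {T T'} hT hT' f => (hT (T' f)).trans (congr_arg T (hT' f))
      add_mem' := fun {T T'} hT hT' f => by
        rw [add_apply, add_apply, map_add, hT, hT']
      algebraMap_mem' := fun r f => by
        rw [Algebra.algebraMap_eq_smul_one]
        exact map_real_smul K K.continuous r f }
  have hS : IsClosed (S : Set (H →L[ℂ] H)) := by
    change IsClosed {T : H →L[ℂ] H | ∀ f, K (T f) = T (K f)}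
    simp only [Set.ofPred_forall]
    exact isClosed_iInter fun f => isClosed_eq (by fun_prop) (by fun_prop)
  exact hρ.realAction_mem_of_isClosed hv hS hK a f

/-- The restriction of a complex-linear action of a real algebra to an invariant real subspace. -/
noncomputable def restrictReal {A : Type*} [Ring A] [Algebra ℝ A] (g : A →ₐ[ℝ] (H →L[ℂ] H))
    {F : Submodule ℝ H} (hF : ∀ a, ∀ f ∈ F, g a f ∈ F) : A →ₐ[ℝ] (F →L[ℝ] F) :=
  AlgHom.ofLinearMap
    { toFun := fun a => ((g a).restrictScalars ℝ).restrict (hF a)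
      map_add' := fun a b => ContinuousLinearMap.ext fun f =>
        Subtype.ext (DFunLike.congr_fun (map_add g a b) (f : H))
      map_smul' := fun r a => ContinuousLinearMap.ext fun f =>
        Subtype.ext (DFunLike.congr_fun (map_smul g r a) (f : H)) }
    (ContinuousLinearMap.ext fun f => Subtype.ext (DFunLike.congr_fun (map_one g) (f : H)))
    fun a b => ContinuousLinearMap.ext fun f =>
      Subtype.ext (DFunLike.congr_fun (map_mul g a b) (f : H))

theorem HasTrivialCommutant.isIrredRep {𝕜 A V : Type*} [RCLike 𝕜] [Ring A] [Algebra 𝕜 A]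
    [NormedAddCommGroup V] [InnerProductSpace 𝕜 V] [CompleteSpace V] [Nontrivial V]
    {ρ : A →ₐ[𝕜] (V →L[𝕜] V)} {g : ι → A} (h : HasTrivialCommutant fun i => ρ (g i))
    (hskew : ∀ i v w, inner 𝕜 (ρ (g i) v) w = -inner 𝕜 v (ρ (g i) w)) : IsIrredRep ρ :=
  ⟨‹_›, fun _ hU hinv => h.eq_bot_or_eq_top hskew hU fun i => hinv (g i)⟩

theorem IsRealForm.isIrredRep [InnerProductSpace ℝ H] [CompleteSpace H] [Nontrivial H]
    {K : H →L⋆[ℂ] H} {F : Submodule ℝ H} (h : IsRealForm K F) {A : Type*} [Ring A] [Algebra ℝ A]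
    {ρR : A →ₐ[ℝ] (F →L[ℝ] F)} {g : ι → A} (hcomm : HasTrivialCommutant fun i => ρR (g i))
    {a : ι → H →L[ℂ] H} (ha : ∀ i (u : F), (ρR (g i) u : H) = a i u)
    (hskew : ∀ i v w, inner ℂ (a i v) w = -inner ℂ v (a i w)) : IsIrredRep ρR := by
  have : CompleteSpace F := h.isClosed.completeSpace_coe
  have : Nontrivial F := h.nontrivial
  refine hcomm.isIrredRep fun i v w => ?_
  rw [Submodule.coe_inner, Submodule.coe_inner, ha, ha, real_inner_eq_re_complex_inner,
    real_inner_eq_re_complex_inner, hskew, Complex.neg_re]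

theorem nontrivial_Lp_two {X : Type*} [TopologicalSpace X] [CompactSpace X] [Nonempty X]
    [MeasurableSpace X] [BorelSpace X] (μ : Measure X) [IsFiniteMeasure μ] [μ.IsOpenPosMeasure] :
    Nontrivial (Lp ℂ 2 μ) :=
  (ContinuousMap.toLp_injective (p := 2) (𝕜 := ℂ) (E := ℂ) μ).nontrivial

end Irreducibility

theorem theorem3p11_general {Z : Type*} [NormedAddCommGroup Z] [InnerProductSpace ℝ Z]
    (σ : Z →ₗᵢ[ℝ] Z) (z : ℕ+ → Z)
    (hz : Orthonormal ℝ (Sum.elim z (fun k => σ (z k))))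
    (hz_dense : (Submodule.span ℝ
      (Set.range (Sum.elim z (fun k => σ (z k))))).topologicalClosure = ⊤)
    {c : ℕ+ → BinSeq → ℂ} (hc : IsGWCoeff c)
    (hc_refl : ∀ k x, conj (c k (1 - x)) = (-1) ^ (k : ℕ) * c k x)
    (μ : Measure BinSeq) [μ.IsAddHaarMeasure] :
    ∃ ρ : CplxCl Z →ₐ[ℂ] (Lp ℂ 2 μ →L[ℂ] Lp ℂ 2 μ),
      IsGWRep σ z μ c ρ ∧
      (∀ ρ' : CplxCl Z →ₐ[ℂ] (Lp ℂ 2 μ →L[ℂ] Lp ℂ 2 μ), IsGWRep σ z μ c ρ' → ρ' = ρ) ∧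
      IsIrredRep ρ ∧
      (∀ (a : RealCl Z), ∀ f ∈ realForm μ, ρ (1 ⊗ₜ[ℝ] a) f ∈ realForm μ) ∧
      ∃ ρR : RealCl Z →ₐ[ℝ] (realForm μ →L[ℝ] realForm μ),
        (∀ (a : RealCl Z) (f : realForm μ),
          (ρR a f : Lp ℂ 2 μ) = ρ (1 ⊗ₜ[ℝ] a) (f : Lp ℂ 2 μ)) ∧
        IsIrredRep ρR ∧
        ∀ (W : Type*) [NormedAddCommGroup W] [InnerProductSpace ℂ W] [CompleteSpace W]
          (τ : CplxCl Z →ₐ[ℂ] (W →L[ℂ] W)),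
          ¬ ∃ φ : realForm μ ≃L[ℝ] W, ∀ (a : RealCl Z) (f : realForm μ),
            φ (ρR a f) = τ (1 ⊗ₜ[ℝ] a) (φ f) := by
  let v := Sum.elim z fun k => σ (z k)
  obtain ⟨ρ, hρ, hρv⟩ := (hc.isSkewCliffordFamily_gwOp μ hz).exists_isSkewRep hz_dense
  have hskew : ∀ t f g, inner ℂ (hc.gwOp μ t f) g = -inner ℂ f (hc.gwOp μ t g) := fun t f g => by
    rw [← ContinuousLinearMap.adjoint_inner_right, hc.adjoint_gwOp, neg_apply, inner_neg_right]
  have : Nontrivial (Lp ℂ 2 μ) := nontrivial_Lp_two μ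
  have hreal := isRealForm_conjReflect μ
  have hK := hc.conjReflect_gwOp μ hc_refl
  have hinv : ∀ a, ∀ f ∈ realForm μ, realAction ρ a f ∈ realForm μ := fun a f hf => by
    rw [hreal.mem_iff, hρ.comm_realAction hz_dense (fun t f => by rw [hρv, hK]),
      hreal.mem_iff.1 hf]
  let ρR := restrictReal (realAction ρ) hinv
  have hρR : ∀ t (f : realForm μ), (ρR (clGen (v t)) f : Lp ℂ 2 μ) = hc.gwOp μ t f :=
    fun t f => DFunLike.congr_fun (hρv t) (f : Lp ℂ 2 μ)
  have hcommC : HasTrivialCommutant fun t => ρ (1 ⊗ₜ[ℝ] clGen (v t)) :=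
    (funext hρv) ▸ hc.hasTrivialCommutant_gwOp μ
  have hcommR : HasTrivialCommutant fun t => ρR (clGen (v t)) :=
    hreal.hasTrivialCommutant (hc.hasTrivialCommutant_gwOp μ) hK hρR
  have : Nontrivial (realForm μ) := hreal.nontrivial
  refine ⟨ρ, (hc.isGWRep_iff μ).2 ⟨hρ, hρv⟩, fun ρ' hρ' => ?_,
    hcommC.isIrredRep fun t => by rw [hρv]; exact hskew t, hinv, ρR, fun _ _ => rfl,
    hreal.isIrredRep hcommR hρR hskew, fun W _ _ _ τ ⟨φ, hφ⟩ => ?_⟩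
  · obtain ⟨hskew', hρv'⟩ := (hc.isGWRep_iff μ).1 hρ'
    exact hskew'.ext hρ hz_dense fun t => (hρv' t).trans (hρv t).symm
  · exact hcommR.not_exists_intertwining_complex (fun t => τ (1 ⊗ₜ[ℝ] clGen (v t)))
      ⟨φ, fun t => hφ _⟩

/-- For every real inner product space `Z` with a compatible complex structure `σ` and a unitary
basis `z_1, z_2, …` (so that the `z_k`, `σ(z_k)` form a real orthonormal basis), and every Haar
measure `μ` on `X = {0,1}^ℕ`. -/
theorem theorem3p11 {Z : Type*} [NormedAddCommGroup Z] [InnerProductSpace ℝ Z]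
    (σ : Z →ₗᵢ[ℝ] Z) (hσ : ∀ v : Z, σ (σ v) = -v) (z : ℕ+ → Z)
    (hz : Orthonormal ℝ (Sum.elim z (fun k => σ (z k))))
    (hz_dense : (Submodule.span ℝ
      (Set.range (Sum.elim z (fun k => σ (z k))))).topologicalClosure = ⊤)
    (μ : Measure BinSeq) [μ.IsAddHaarMeasure] :
    IsGWCoeff splitCoeff ∧
    ∃ ρ : CplxCl Z →ₐ[ℂ] (Lp ℂ 2 μ →L[ℂ] Lp ℂ 2 μ),
      IsGWRep σ z μ splitCoeff ρ ∧
      (∀ ρ' : CplxCl Z →ₐ[ℂ] (Lp ℂ 2 μ →L[ℂ] Lp ℂ 2 μ),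
        IsGWRep σ z μ splitCoeff ρ' → ρ' = ρ) ∧
      IsIrredRep ρ ∧
      (∀ (a : RealCl Z), ∀ f ∈ realForm μ, ρ (1 ⊗ₜ[ℝ] a) f ∈ realForm μ) ∧
      ∃ ρR : RealCl Z →ₐ[ℝ] (realForm μ →L[ℝ] realForm μ),
        (∀ (a : RealCl Z) (f : realForm μ),
          (ρR a f : Lp ℂ 2 μ) = ρ (1 ⊗ₜ[ℝ] a) (f : Lp ℂ 2 μ)) ∧
        IsIrredRep ρR ∧
        ∀ (W : Type*) [NormedAddCommGroup W] [InnerProductSpace ℂ W] [CompleteSpace W]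
          (τ : CplxCl Z →ₐ[ℂ] (W →L[ℂ] W)),
          ¬ ∃ φ : realForm μ ≃L[ℝ] W, ∀ (a : RealCl Z) (f : realForm μ),
            φ (ρR a f) = τ (1 ⊗ₜ[ℝ] a) (φ f) := by
  exact ⟨isGWCoeff_splitCoeff, theorem3p11_general σ z hz hz_dense isGWCoeff_splitCoeff
    conj_splitCoeff_one_sub μ⟩
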